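/- Let $\Phi : M \to N$ be a smooth map of manifolds (more generally, a continuous map of topological spaces), and let $n \ge 0$. For an abelian group $A$ let $S_q(X,\mathbb{Z})$ be the group of integral singular $q$-chains of $X$ ($S_{-1}=0$) and $S^q(X,A)=\operatorname{Hom}(S_q(X,\mathbb{Z}),A)$ the group of singular $q$-cochains; for $\theta\in S_q(X,\mathbb{Z})$ and $\alpha\in S^q(X,A)$ write $\int_\theta\alpha := \langle\alpha,\theta\rangle\in A$ for the Kronecker pairing. Let $$\operatorname{Cone}_n(\Phi,\mathbb{Z})=S_{n-1}(M,\mathbb{Z})\oplus S_n(N,\mathbb{Z}),\qquad \partial(\theta,\eta)=(\partial\theta,\ \Phi_*\theta-\partial\eta),$$ and let $H^n(\Phi,A)$ be the $n$-th cohomology of the cochain complex $S^{n-1}(M,A)\oplus S^n(N,A)$ with differential $d(\alpha,\beta)=(\Phi^*\beta-d\alpha,\ d\beta)$. A class in $H^n(\Phi,\mathbb{R})$ is called integral if it lies in the image of the homomorphism $\iota : H^n(\Phi,\mathbb{Z})\to H^n(\Phi,\mathbb{R})$ induced by the inclusion $\mathbb{Z}\to\mathbb{R}$. Then a class $[(\alpha,\beta)]\in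 H^n(\Phi,\mathbb{R})$ is integral if and only if $$\int_\theta\alpha-\int_\eta\beta\in\mathbb{Z}\qquad\text{for all cycles }(\theta,\eta)\in\operatorname{Cone}_n(\Phi,\mathbb{Z}).$$ -/

import Mathlib

noncomputable section

namespace RelSing

/-- Singular simplices of `X` with `k` vertices, i.e. of dimension `k - 1`: continuous maps from the
standard simplex on `k` vertices to `X`.  There are none for `k = 0` (dimension `-1`): the singular
complex is not augmented. -/
def Simplices (X : Type*) [TopologicalSpace X] : ℕ → Type _
  | 0 => PEmpty
  | k + 1 => C(stdSimplex ℝ (Fin (k + 1)), X)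

/-- The group `S_{k-1}(X, ℤ)` of integral singular chains of dimension `k - 1`, free on the singular
simplices with `k` vertices; it is `0` for `k = 0`. -/
abbrev Chains (X : Type*) [TopologicalSpace X] (k : ℕ) : Type _ :=
  Simplices X k →₀ ℤ

/-- The `i`-th face of a singular simplex of positive dimension, opposite to the `i`-th vertex. -/
def face {X : Type*} [TopologicalSpace X] {k : ℕ} (i : Fin (k + 2)) (σ : Simplices X (k + 2)) :
    Simplices X (k + 1) :=
  ContinuousMap.comp (σ : C(stdSimplex ℝ (Fin (k + 2)), X))
    ⟨stdSimplex.map i.succAbove, stdSimplex.continuous_map _⟩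

/-- The singular boundary operator `∂ : S_k(X, ℤ) → S_{k-1}(X, ℤ)`, `∂σ = ∑ i, (-1)^i • (σ ∘ δ_i)`
on simplices of dimension `k ≥ 1`, and zero on simplices of dimension `0`. -/
def boundary (X : Type*) [TopologicalSpace X] : (k : ℕ) → Chains X (k + 1) →+ Chains X k
  | 0 => 0
  | _ + 1 => Finsupp.liftAddHom fun σ =>
      zmultiplesHom _ (∑ i, Finsupp.single (face i σ) ((-1 : ℤ) ^ (i : ℕ)))

/-- The action of a continuous map on singular simplices, `σ ↦ Φ ∘ σ`. -/
def pushSimplex {X Y : Type*} [TopologicalSpace X] [TopologicalSpace Y] (Φ : C(X, Y)) :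
    (k : ℕ) → Simplices X k → Simplices Y k
  | 0 => PEmpty.elim
  | k + 1 => fun σ => ContinuousMap.comp Φ (σ : C(stdSimplex ℝ (Fin (k + 1)), X))

/-- The push-forward `Φ_* : S_{k-1}(X, ℤ) → S_{k-1}(Y, ℤ)`. -/
def push {X Y : Type*} [TopologicalSpace X] [TopologicalSpace Y] (Φ : C(X, Y)) (k : ℕ) :
    Chains X k →+ Chains Y k :=
  Finsupp.mapDomain.addMonoidHom (pushSimplex Φ k)

/-- The group `S^{k-1}(X, A) = Hom(S_{k-1}(X, ℤ), A)` of singular cochains with values in `A`. -/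
abbrev Cochains (X : Type*) [TopologicalSpace X] (A : Type*) [AddCommGroup A] (k : ℕ) : Type _ :=
  Chains X k →+ A

/-- The integral `∫_θ α` of a cochain over a chain: the Kronecker pairing `⟨α, θ⟩`. -/
def integral {X : Type*} [TopologicalSpace X] {A : Type*} [AddCommGroup A] {k : ℕ}
    (θ : Chains X k) (α : Cochains X A k) : A :=
  α θ

/-- The singular coboundary operator `d : S^{k-1}(X, A) → S^k(X, A)`, dual to the boundary. -/
def coboundary (X : Type*) [TopologicalSpace X] (A : Type*) [AddCommGroup A] (k : ℕ) :
    Cochains X A k →+ Cochains X A (k + 1) :=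
  AddMonoidHom.compHom' (boundary X k)

/-- The pull-back `Φ^* : S^{k-1}(Y, A) → S^{k-1}(X, A)`, dual to the push-forward. -/
def pull {X Y : Type*} [TopologicalSpace X] [TopologicalSpace Y] (Φ : C(X, Y))
    (A : Type*) [AddCommGroup A] (k : ℕ) : Cochains Y A k →+ Cochains X A k :=
  AddMonoidHom.compHom' (push Φ k)

section Relative

variable {M N : Type*} [TopologicalSpace M] [TopologicalSpace N] (Φ : C(M, N))

/-- `Cone_n(Φ, ℤ) = S_{n-1}(M, ℤ) ⊕ S_n(N, ℤ)`. -/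
abbrev RelChains (_Φ : C(M, N)) (n : ℕ) : Type _ :=
  Chains M n × Chains N (n + 1)

/-- The differential `∂(θ, η) = (∂θ, Φ_* θ - ∂η)` from `Cone_{n+1}(Φ, ℤ)` to `Cone_n(Φ, ℤ)`. -/
def relBoundary (n : ℕ) : RelChains Φ (n + 1) →+ RelChains Φ n :=
  ((boundary M n).comp (AddMonoidHom.fst _ _)).prod
    ((push Φ (n + 1)).comp (AddMonoidHom.fst _ _) -
      (boundary N (n + 1)).comp (AddMonoidHom.snd _ _))

/-- The cycles of `Cone_n(Φ, ℤ)`.  Every element of `Cone_0(Φ, ℤ)` is a cycle. -/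
def relCycles : (n : ℕ) → AddSubgroup (RelChains Φ n)
  | 0 => ⊤
  | n + 1 => (relBoundary Φ n).ker

variable (A : Type*) [AddCommGroup A]

/-- `Cone^n(Φ^*) = S^{n-1}(M, A) ⊕ S^n(N, A)`. -/
abbrev RelCochains (_Φ : C(M, N)) (A : Type*) [AddCommGroup A] (n : ℕ) : Type _ :=
  Cochains M A n × Cochains N A (n + 1)

/-- The differential `d(α, β) = (Φ^* β - dα, dβ)` of `Cone^•(Φ^*)`. -/
def relCoboundary (n : ℕ) : RelCochains Φ A n →+ RelCochains Φ A (n + 1) :=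
  ((pull Φ A (n + 1)).comp (AddMonoidHom.snd _ _) -
      (coboundary M A n).comp (AddMonoidHom.fst _ _)).prod
    ((coboundary N A (n + 1)).comp (AddMonoidHom.snd _ _))

/-- The relative cocycles of degree `n`. -/
def relCocycles (n : ℕ) : AddSubgroup (RelCochains Φ A n) :=
  (relCoboundary Φ A n).ker

/-- The relative coboundaries of degree `n`: the image of `Cone^{n-1}(Φ^*)`, which is `0` for
`n = 0`. -/
def relCoboundaries : (n : ℕ) → AddSubgroup (RelCochains Φ A n)
  | 0 => ⊥
  | n + 1 => (relCoboundary Φ A n).range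

/-- The relative singular cohomology group `H^n(Φ, A)`: cocycles modulo coboundaries. -/
abbrev RelCohomology (n : ℕ) : Type _ :=
  relCocycles Φ A n ⧸ (relCoboundaries Φ A n).addSubgroupOf (relCocycles Φ A n)

variable {A}

/-- The class `[(α, β)] ∈ H^n(Φ, A)` of a relative cocycle. -/
def relClass {n : ℕ} (c : relCocycles Φ A n) : RelCohomology Φ A n :=
  QuotientAddGroup.mk c

variable {B : Type*} [AddCommGroup B] (κ : A →+ B)

/-- The map on relative cochains induced by a homomorphism of coefficient groups,
`(α, β) ↦ (κ ∘ α, κ ∘ β)`. -/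
def coeffCochains (n : ℕ) : RelCochains Φ A n →+ RelCochains Φ B n :=
  (AddMonoidHom.compHom κ).prodMap (AddMonoidHom.compHom κ)

lemma coeffCochains_relCoboundary (n : ℕ) (c : RelCochains Φ A n) :
    coeffCochains Φ κ (n + 1) (relCoboundary Φ A n c) =
      relCoboundary Φ B n (coeffCochains Φ κ n c) := by
  refine Prod.ext ?_ ?_ <;> ext x <;>
    simp [coeffCochains, relCoboundary, pull, coboundary]

/-- The map induced by a homomorphism of coefficient groups on relative cocycles. -/
def coeffCocycles (n : ℕ) : relCocycles Φ A n →+ relCocycles Φ B n :=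
  ((coeffCochains Φ κ n).comp (relCocycles Φ A n).subtype).codRestrict (relCocycles Φ B n)
    (fun c => by
      have h : relCoboundary Φ A n c = 0 := c.2
      change relCoboundary Φ B n (coeffCochains Φ κ n c) = 0
      rw [← coeffCochains_relCoboundary, h, map_zero])

lemma coeffCochains_mem_relCoboundaries (n : ℕ) (c : RelCochains Φ A n)
    (hc : c ∈ relCoboundaries Φ A n) : coeffCochains Φ κ n c ∈ relCoboundaries Φ B n := by
  cases n with
  | zero =>
    obtain rfl : c = 0 := hc
    rw [map_zero]
    exact zero_mem _
  | succ n =>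
    obtain ⟨b, rfl⟩ := hc
    exact ⟨coeffCochains Φ κ n b, (coeffCochains_relCoboundary Φ κ n b).symm⟩

/-- The homomorphism `κ : H^n(Φ, A) → H^n(Φ, B)` induced by `κ : A → B`. -/
def coeffCohomology (n : ℕ) : RelCohomology Φ A n →+ RelCohomology Φ B n :=
  QuotientAddGroup.map _ _ (coeffCocycles Φ κ n) (fun c hc =>
    coeffCochains_mem_relCoboundaries Φ κ n c hc)

/-- A class in `H^n(Φ, ℝ)` is integral if it lies in the image of
`ι : H^n(Φ, ℤ) → H^n(Φ, ℝ)`, induced by the inclusion `ℤ → ℝ`. -/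
def IsIntegral {n : ℕ} (γ : RelCohomology Φ ℝ n) : Prop :=
  γ ∈ (coeffCohomology Φ (Int.castAddHom ℝ) n).range

end Relative

end RelSing

end

namespace RelSing

/-! The pairing identifies relative cochains with `Hom(Cone_n, A)` and turns `d` into minus the
transpose of `∂`. Coboundaries therefore vanish on cycles, so a class with an integral
representative has integral periods.

Conversely, let `f : Cone_n → ℝ` be integral on `ker ∂`. Modulo `ℤ` it descends to `im ∂`. It
extends to all of `Cone_{n-1}` since `ℝ/ℤ` is divisible, hence injective, and the extension lifts to
a real `h` since `Cone_{n-1}` is free. Then `f - h ∘ ∂` is integer-valued and cohomologous to `f`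
(`exists_sub_comp_integral`, `exists_coeffCochains_sub_mem`). -/

/-- A real-valued homomorphism taking only integral values comes from an integer-valued one. -/
lemma exists_castAddHom_comp_eq {C : Type*} [AddCommGroup C] (f : C →+ ℝ)
    (hf : ∀ x, ∃ m : ℤ, f x = m) : ∃ g : C →+ ℤ, (Int.castAddHom ℝ).comp g = f := by
  choose g hg using hf
  refine ⟨AddMonoidHom.mk' g fun x y => ?_, ?_⟩
  · have h := map_add f x y
    rw [hg, hg, hg] at h
    exact_mod_cast h
  · ext x
    simp [hg]

/-- If `f` is integral on the kernel of `∂ : C → D` and `D` is free, then `f` differs from an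
integer-valued homomorphism by one which factors through `∂`. -/
lemma exists_sub_comp_integral {C D : Type*} [AddCommGroup C] [AddCommGroup D]
    [Module.Projective ℤ D] (d : C →+ D) (f : C →+ ℝ)
    (hf : ∀ x, d x = 0 → ∃ m : ℤ, f x = m) :
    ∃ h : D →+ ℝ, ∀ x, ∃ m : ℤ, f x - h (d x) = m := by
  let q : ℝ →+ AddCircle (1 : ℝ) := QuotientAddGroup.mk' _
  have hq : ∀ r : ℝ, q r = 0 ↔ ∃ m : ℤ, r = m := fun r => by
    refine (AddCircle.coe_eq_zero_iff (1 : ℝ)).trans ?_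
    simp [eq_comm]
  have hker : d.ker ≤ (q.comp f).ker := fun x hx => (hq _).2 (hf x hx)
  let g : C ⧸ d.ker →+ AddCircle (1 : ℝ) := QuotientAddGroup.lift d.ker (q.comp f) hker
  -- Injectivity of `ℝ/ℤ` extends `g` along the embedding of `C ⧸ d.ker` into `D`.
  obtain ⟨e, he⟩ := (Module.Baer.of_divisible (AddCircle (1 : ℝ))).extension_property_addMonoidHom
    (QuotientAddGroup.kerLift d) (QuotientAddGroup.kerLift_injective d) g
  -- Projectivity of `D` lifts `e` through the quotient map `ℝ → ℝ/ℤ`.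
  obtain ⟨h, hh⟩ := Module.projective_lifting_property q.toIntLinearMap e.toIntLinearMap
    (QuotientAddGroup.mk'_surjective _)
  refine ⟨h.toAddMonoidHom, fun x => (hq _).1 ?_⟩
  have h₁ : q (h (d x)) = e (d x) := LinearMap.congr_fun hh (d x)
  have h₂ : e (d x) = q (f x) := DFunLike.congr_fun he (QuotientAddGroup.mk x)
  rw [map_sub, sub_eq_zero]
  exact (h₁.trans h₂).symm

/-! ### Identities of the singular boundary -/

section Singular

variable {X Y : Type*} [TopologicalSpace X] [TopologicalSpace Y]

lemma boundary_single {k : ℕ} (σ : Simplices X (k + 2)) :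
    boundary X (k + 1) (Finsupp.single σ 1) =
      ∑ i, Finsupp.single (face i σ) ((-1 : ℤ) ^ (i : ℕ)) := by
  simp [boundary]

lemma boundary_single' {k : ℕ} (σ : Simplices X (k + 2)) (m : ℤ) :
    boundary X (k + 1) (Finsupp.single σ m) =
      ∑ i, Finsupp.single (face i σ) (m * (-1 : ℤ) ^ (i : ℕ)) := by
  simp [boundary, Finset.smul_sum]

/-- Both sides delete the same two vertices, in opposite orders. -/
lemma face_face {k : ℕ} (σ : Simplices X (k + 3)) (i : Fin (k + 3)) (j : Fin (k + 2)) :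
    face (j.predAbove i) (face (i.succAbove j) σ) = face j (face i σ) := by
  let s : C(stdSimplex ℝ (Fin (k + 3)), X) := σ
  refine ContinuousMap.ext fun x => ?_
  change s (stdSimplex.map (i.succAbove j).succAbove
      (stdSimplex.map (j.predAbove i).succAbove x)) =
    s (stdSimplex.map i.succAbove (stdSimplex.map j.succAbove x))
  rw [stdSimplex.map_comp_apply, stdSimplex.map_comp_apply]
  congr 2
  funext l
  exact Fin.succAbove_succAbove_succAbove_predAbove i j l

/-- `∂ ∘ ∂ = 0` on singular chains. -/
lemma boundary_boundary (k : ℕ) (x : Chains X (k + 2)) :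
    boundary X k (boundary X (k + 1) x) = 0 := by
  cases k with
  | zero => rfl
  | succ k =>
    suffices (boundary X (k + 1)).comp (boundary X (k + 2)) = 0 from DFunLike.congr_fun this x
    refine Finsupp.addHom_ext' fun σ => AddMonoidHom.ext_int ?_
    change boundary X (k + 1) (boundary X (k + 2) (Finsupp.single σ 1)) = 0
    rw [boundary_single, map_sum]
    simp_rw [boundary_single', ← pow_add]
    rw [← Fintype.sum_prod_type']
    -- Exchanging the order of the two deletions keeps the face and flips the sign, so the terms
    -- cancel in pairs.
    refine Finset.sum_involution
      (fun p _ => (p.1.succAbove p.2, p.2.predAbove p.1)) ?_ ?_ ?_ ?_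
    · rintro ⟨i, j⟩ -
      change _ + Finsupp.single (face (j.predAbove i) (face (i.succAbove j) σ))
        ((-1 : ℤ) ^ ((i.succAbove j : ℕ) + (j.predAbove i : ℕ))) = 0
      rw [face_face, Fin.neg_one_pow_succAbove_add_predAbove, ← Finsupp.single_add]
      simp
    · rintro ⟨i, j⟩ - - h
      exact Fin.succAbove_ne i j (congrArg Prod.fst h)
    · intros
      exact Finset.mem_univ _
    · rintro ⟨i, j⟩ -
      exact Prod.ext (Fin.succAbove_succAbove_predAbove i j)
        (Fin.predAbove_predAbove_succAbove i j)

/-- The push-forward is a chain map. -/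
lemma boundary_push (Φ : C(X, Y)) (k : ℕ) (x : Chains X (k + 1)) :
    boundary Y k (push Φ (k + 1) x) = push Φ k (boundary X k x) := by
  cases k with
  | zero => exact (map_zero _).symm
  | succ k =>
    suffices (boundary Y (k + 1)).comp (push Φ (k + 2)) =
      (push Φ (k + 1)).comp (boundary X (k + 1)) from DFunLike.congr_fun this x
    refine Finsupp.addHom_ext' fun σ => AddMonoidHom.ext_int ?_
    change boundary Y (k + 1) (Finsupp.mapDomain (pushSimplex Φ (k + 2)) (Finsupp.single σ 1)) =
      push Φ (k + 1) (boundary X (k + 1) (Finsupp.single σ 1))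
    rw [Finsupp.mapDomain_single, boundary_single, boundary_single, map_sum]
    exact Finset.sum_congr rfl fun i _ =>
      (Finsupp.mapDomain_single (f := pushSimplex Φ (k + 1)) (a := face i σ)).symm

end Singular

/-! ### Duality between relative chains and cochains -/

section Relative

variable {M N : Type*} [TopologicalSpace M] [TopologicalSpace N] (Φ : C(M, N))

/-- `∂ ∘ ∂ = 0` on relative chains. -/
lemma relBoundary_relBoundary (n : ℕ) (x : RelChains Φ (n + 2)) :
    relBoundary Φ n (relBoundary Φ (n + 1) x) = 0 := by
  refine Prod.ext (boundary_boundary n x.1) ?_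
  change push Φ (n + 1) (boundary M (n + 1) x.1) -
    boundary N (n + 1) (push Φ (n + 2) x.1 - boundary N (n + 2) x.2) = 0
  rw [map_sub, boundary_boundary, boundary_push, sub_zero, sub_self]

variable {A : Type*} [AddCommGroup A]

/-- The pairing `∫_θ α - ∫_η β` of relative cochains with relative chains. -/
noncomputable def relPairing (n : ℕ) : RelCochains Φ A n ≃+ (RelChains Φ n →+ A) where
  toFun c := c.1.comp (AddMonoidHom.fst _ _) - c.2.comp (AddMonoidHom.snd _ _)
  invFun f := (f.comp (AddMonoidHom.inl _ _), -f.comp (AddMonoidHom.inr _ _))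
  left_inv c := by
    refine Prod.ext ?_ ?_ <;> ext <;> simp
  right_inv f := by
    refine AddMonoidHom.ext fun x => ?_
    simp [← map_add]
  map_add' c c' := by
    refine AddMonoidHom.ext fun x => ?_
    simp only [Prod.fst_add, Prod.snd_add, AddMonoidHom.add_comp, AddMonoidHom.sub_apply,
      AddMonoidHom.add_apply]
    abel

lemma relPairing_apply (n : ℕ) (c : RelCochains Φ A n) (x : RelChains Φ n) :
    relPairing Φ n c x = c.1 x.1 - c.2 x.2 := rfl

/-- Stokes' theorem for the relative pairing. -/
lemma relPairing_relCoboundary (n : ℕ) (c : RelCochains Φ A n) (x : RelChains Φ (n + 1)) :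
    relPairing Φ (n + 1) (relCoboundary Φ A n c) x = -relPairing Φ n c (relBoundary Φ n x) := by
  change c.2 (push Φ (n + 1) x.1) - c.1 (boundary M n x.1) - c.2 (boundary N (n + 1) x.2) =
    -(c.1 (boundary M n x.1) - c.2 (push Φ (n + 1) x.1 - boundary N (n + 1) x.2))
  rw [map_sub]
  abel

lemma relCoboundary_relCoboundary (n : ℕ) (c : RelCochains Φ A n) :
    relCoboundary Φ A (n + 1) (relCoboundary Φ A n c) = 0 := by
  apply (relPairing Φ (n + 2)).injective
  refine AddMonoidHom.ext fun x => ?_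
  rw [relPairing_relCoboundary, relPairing_relCoboundary, relBoundary_relBoundary]
  simp

variable {Φ}

/-- This makes periods over cycles depend only on the cohomology class. -/
lemma relPairing_eq_zero {n : ℕ} {c : RelCochains Φ A n} (hc : c ∈ relCoboundaries Φ A n)
    {x : RelChains Φ n} (hx : x ∈ relCycles Φ n) : relPairing Φ n c x = 0 := by
  cases n with
  | zero =>
    obtain rfl : c = 0 := hc
    simp
  | succ n =>
    obtain ⟨b, rfl⟩ := hc
    rw [relPairing_relCoboundary, show relBoundary Φ n x = 0 from hx, map_zero, neg_zero]

lemma relCoboundaries_le_relCocycles (n : ℕ) : relCoboundaries Φ A n ≤ relCocycles Φ A n := by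
  cases n with
  | zero => exact bot_le
  | succ n =>
    rintro _ ⟨b, rfl⟩
    exact relCoboundary_relCoboundary Φ n b

variable (Φ)

lemma relPairing_coeffCochains {B : Type*} [AddCommGroup B] (κ : A →+ B) (n : ℕ)
    (c : RelCochains Φ A n) (x : RelChains Φ n) :
    relPairing Φ n (coeffCochains Φ κ n c) x = κ (relPairing Φ n c x) :=
  (map_sub κ _ _).symm

lemma coeffCochains_injective {B : Type*} [AddCommGroup B] {κ : A →+ B}
    (hκ : Function.Injective κ) (n : ℕ) : Function.Injective (coeffCochains Φ κ n) := by
  intro c c' h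
  apply (relPairing Φ n).injective
  refine AddMonoidHom.ext fun x => hκ ?_
  rw [← relPairing_coeffCochains, h, relPairing_coeffCochains]

variable {Φ}

/-- A relative cochain which is integral on cycles is cohomologous to an integral one. -/
lemma exists_coeffCochains_sub_mem {n : ℕ} {c : RelCochains Φ ℝ n}
    (hc : ∀ x ∈ relCycles Φ n, ∃ m : ℤ, relPairing Φ n c x = m) :
    ∃ g : RelCochains Φ ℤ n,
      c - coeffCochains Φ (Int.castAddHom ℝ) n g ∈ relCoboundaries Φ ℝ n := by
  obtain ⟨b, hb, hint⟩ : ∃ b ∈ relCoboundaries Φ ℝ n,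
      ∀ x, ∃ m : ℤ, relPairing Φ n (c - b) x = m := by
    cases n with
    -- In degree `0` every chain is a cycle, so no correction is needed.
    | zero => exact ⟨0, zero_mem _, fun x => by simpa using hc x trivial⟩
    | succ n =>
      obtain ⟨h, hh⟩ := exists_sub_comp_integral (relBoundary Φ n) (relPairing Φ (n + 1) c) hc
      -- The sign of `-h` offsets the one in `relPairing_relCoboundary`.
      refine ⟨relCoboundary Φ ℝ n ((relPairing Φ n).symm (-h)), ⟨_, rfl⟩, fun x => ?_⟩
      obtain ⟨m, hm⟩ := hh x
      refine ⟨m, ?_⟩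
      rw [map_sub, AddMonoidHom.sub_apply, relPairing_relCoboundary, AddEquiv.apply_symm_apply,
        AddMonoidHom.neg_apply, neg_neg, hm]
  obtain ⟨g, hg⟩ := exists_castAddHom_comp_eq _ hint
  refine ⟨(relPairing Φ n).symm g, ?_⟩
  suffices coeffCochains Φ (Int.castAddHom ℝ) n ((relPairing Φ n).symm g) = c - b by
    rwa [this, sub_sub_cancel]
  apply (relPairing Φ n).injective
  refine AddMonoidHom.ext fun x => ?_
  rw [relPairing_coeffCochains, AddEquiv.apply_symm_apply, ← hg, AddMonoidHom.comp_apply]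

lemma isIntegral_relClass_iff {n : ℕ} (c : relCocycles Φ ℝ n) :
    IsIntegral Φ (relClass Φ c) ↔ ∃ g ∈ relCocycles Φ ℤ n,
      (c : RelCochains Φ ℝ n) - coeffCochains Φ (Int.castAddHom ℝ) n g ∈
        relCoboundaries Φ ℝ n := by
  have key : ∀ g : relCocycles Φ ℤ n,
      coeffCohomology Φ (Int.castAddHom ℝ) n (relClass Φ g) = relClass Φ c ↔
        (c : RelCochains Φ ℝ n) - coeffCochains Φ (Int.castAddHom ℝ) n g ∈
          relCoboundaries Φ ℝ n := fun g => by
    change (QuotientAddGroup.mk (coeffCocycles Φ (Int.castAddHom ℝ) n g) :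
      RelCohomology Φ ℝ n) = QuotientAddGroup.mk c ↔ _
    rw [QuotientAddGroup.eq, neg_add_eq_sub]
    rfl
  constructor
  · rintro ⟨γ, hγ⟩
    obtain ⟨g, rfl⟩ := QuotientAddGroup.mk_surjective γ
    exact ⟨g, g.2, (key g).1 hγ⟩
  · rintro ⟨g, hg, h⟩
    exact ⟨relClass Φ ⟨g, hg⟩, (key ⟨g, hg⟩).2 h⟩

end Relative

end RelSing

theorem mainTheorem8 {M N : Type*} [TopologicalSpace M] [TopologicalSpace N] (Φ : C(M, N)) (n : ℕ)
    (α : RelSing.Cochains M ℝ n) (β : RelSing.Cochains N ℝ (n + 1))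
    (h : (α, β) ∈ RelSing.relCocycles Φ ℝ n) :
    RelSing.IsIntegral Φ (RelSing.relClass Φ ⟨(α, β), h⟩) ↔
      ∀ (θ : RelSing.Chains M n) (η : RelSing.Chains N (n + 1)),
        (θ, η) ∈ RelSing.relCycles Φ n →
          ∃ m : ℤ, RelSing.integral θ α - RelSing.integral η β = m := by
  rw [RelSing.isIntegral_relClass_iff]
  constructor
  · rintro ⟨g, -, hb⟩ θ η hx
    refine ⟨RelSing.relPairing Φ n g (θ, η), ?_⟩
    have h₀ := RelSing.relPairing_eq_zero hb hx
    rw [map_sub, AddMonoidHom.sub_apply, RelSing.relPairing_coeffCochains, sub_eq_zero] at h₀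
    exact h₀
  · intro H
    obtain ⟨g, hb⟩ := RelSing.exists_coeffCochains_sub_mem (c := (α, β))
      fun x hx => H x.1 x.2 hx
    refine ⟨g, ?_, hb⟩
    -- Since `ℤ → ℝ` is injective, closedness of `g` can be tested over `ℝ`, where `g` is a cocycle
    -- minus a coboundary.
    apply RelSing.coeffCochains_injective Φ (κ := Int.castAddHom ℝ) Int.cast_injective
    have hg := sub_mem h (RelSing.relCoboundaries_le_relCocycles n hb)
    rw [sub_sub_cancel] at hg
    rw [RelSing.coeffCochains_relCoboundary, map_zero]
    exact hg
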